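/- A unital ring $S$ is called a left (resp. right) Köthe ring if every left (resp. right) $S$-module is a direct sum of cyclic submodules. Let $R$ be a division ring of characteristic $0$, let $G$ be an arbitrary group, and let $R[G]$ denote the group ring of $G$ over $R$, that is, the free left $R$-module with basis $G$ and multiplication determined by $(r_1g_1)(r_2g_2) = r_1r_2\,g_1g_2$ for $r_1,r_2\in R$ and $g_1,g_2\in G$. Then the following three assertions are equivalent: (i) the group ring $R[G]$ is a left Köthe ring; (ii) the group ring $R[G]$ is a right Köthe ring; (iii) $G$ is a finite group. -/

import Mathlib

universe u v w

/-- The (left) `S`-module `M` is the internal direct sum of a family of cyclic submodules. -/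
def IsDirectSumOfCyclics (S : Type u) [Ring S] (M : Type w) [AddCommGroup M] [Module S M] : Prop :=
  open Classical in
  ∃ (ι : Type w) (N : ι → Submodule S M),
    DirectSum.IsInternal N ∧ ∀ i, (N i).IsPrincipal

/-- Every left `S`-module is a direct sum of cyclic submodules. The universe `w` of the modules
is explicit; it is meant to be at least as large as that of `S`. -/
def IsLeftKothe (S : Type u) [Ring S] : Prop :=
  ∀ (M : Type w) [AddCommGroup M] [Module S M], IsDirectSumOfCyclics S M

/-- Every right `S`-module (that is, module over the opposite ring) is a direct sum of cyclic
submodules. -/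
def IsRightKothe (S : Type u) [Ring S] : Prop :=
  ∀ (M : Type w) [AddCommGroup M] [Module Sᵐᵒᵖ M], IsDirectSumOfCyclics Sᵐᵒᵖ M

/-! Let `S` be an infinite left Köthe ring. If a chain of principal right ideals descended strictly,
splitting `ℕ → S → S` into cyclic modules would, by Chase's gliding hump argument, inject the
subsets of `S` into a product of finitely many cyclic modules. Such a product has at most `|S|`
elements, against Cantor.

For a group ring in characteristic zero this chain condition forces `G` to be finite. Powers of `x -
1` show that `G` is torsion, and sums over finite subgroups show that the FC-center is finite. The
quotient by the FC-center has no nontrivial finite conjugacy class, so its group ring is semiprime;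
there some `b` of nonzero augmentation annihilates the augmentation ideal. Right translations fix
`b`, whose support is finite, so the quotient is finite.

The converse is Maschke's theorem. Right modules are left modules over the opposite ring, again a
group ring. -/

/-- The descending chain condition on principal right ideals: in a descending chain
`q 0 S ⊇ q 1 S ⊇ ⋯`, some inclusion is an equality. -/
def PrincipalRightDCC (S : Type*) [Monoid S] : Prop :=
  ∀ q : ℕ → S, (∀ n, q n ∣ q (n + 1)) → ∃ n, q (n + 1) ∣ q n

/-! ### Köthe rings and the chain condition -/

/-- Chase's lemma: under a linear map from a countable product to a direct sum, the elements of
`q n • ∏ₖ₌ₙ A` have components in `q (n + 1) • N i` outside a finite set of indices `i`,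
for some `n`. -/
theorem exists_finset_component_mem_smul {S A I : Type*} [Ring S] [AddCommGroup A] [Module S A]
    [DecidableEq I] (N : I → Type*) [∀ i, AddCommGroup (N i)] [∀ i, Module S (N i)]
    (φ : (ℕ → A) →ₗ[S] DirectSum I N) (q : ℕ → S) (hq : ∀ n, q n ∣ q (n + 1)) :
    ∃ (n : ℕ) (F : Finset I), ∀ x : ℕ → A, (∀ k < n, x k = 0) → (∀ k, ∃ y, x k = q n • y) →
      ∀ i ∉ F, ∃ y : N i, φ x i = q (n + 1) • y := by
  classical
  by_contra! H
  choose X hX0 hXq J hJF hJ using H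
  have hdvd : ∀ {m n}, m ≤ n → q m ∣ q n := fun {m n} hmn => by
    induction n, hmn using Nat.le_induction with
    | base => exact dvd_rfl
    | succ n _ ih => exact ih.trans (hq n)
  -- Gliding hump: `F n` contains the supports of the images of all humps chosen before stage `n`,
  -- so the index chosen at stage `n` sees none of them.
  let F : ℕ → Finset I := fun n => Nat.rec ∅ (fun n F => F ∪ DFinsupp.support (φ (X n F))) n
  have hF : ∀ n, F (n + 1) = F n ∪ DFinsupp.support (φ (X n (F n))) := fun n => rfl
  have hFmono : Monotone F := monotone_nat_of_le_succ fun n => by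
    rw [hF]; exact Finset.subset_union_left
  let x : ℕ → ℕ → A := fun n => X n (F n)
  let i : ℕ → I := fun n => J n (F n)
  have hx0 : ∀ n, ∀ k < n, x n k = 0 := fun n => hX0 n (F n)
  have hmem : ∀ {m n}, m < n → ∀ j, φ (x m) j ≠ 0 → j ∈ F n := fun {m n} hmn j hj => by
    apply hFmono (Nat.succ_le_of_lt hmn)
    rw [hF]
    exact Finset.mem_union_right _ (DFinsupp.mem_support_iff.2 hj)
  have hne : ∀ n, φ (x n) (i n) ≠ 0 := fun n h => hJ n (F n) 0 (by rw [smul_zero]; exact h)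
  -- This is the infinite sum of the humps: `x m` vanishes at `k < m`, so each coordinate is a
  -- finite sum.
  let z : ℕ → A := fun k => ∑ m ∈ Finset.range (k + 1), x m k
  have htail : ∀ n, ∃ t : ℕ → A, z = ∑ m ∈ Finset.range (n + 1), x m + q (n + 1) • t := by
    intro n
    have : ∀ k, ∃ y, z k = ∑ m ∈ Finset.range (n + 1), x m k + q (n + 1) • y := by
      intro k
      rcases le_total k n with hk | hk
      · refine ⟨0, ?_⟩
        rw [smul_zero, add_zero]
        refine Finset.sum_subset (Finset.range_mono (by omega)) fun m _ hm => hx0 m k ?_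
        simpa using hm
      · have hy : ∀ m, ∃ y, n + 1 ≤ m → x m k = q (n + 1) • y := fun m => by
          by_cases hm : n + 1 ≤ m
          · obtain ⟨y, hy⟩ := hXq m (F m) k
            obtain ⟨c, hc⟩ := hdvd hm
            exact ⟨c • y, fun _ => by rw [smul_smul, ← hc]; exact hy⟩
          · exact ⟨0, fun h => absurd h hm⟩
        choose y hy using hy
        refine ⟨∑ m ∈ Finset.Ico (n + 1) (k + 1), y m, ?_⟩
        rw [Finset.smul_sum, ← Finset.sum_congr rfl fun m hm => hy m (Finset.mem_Ico.1 hm).1,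
          Finset.sum_range_add_sum_Ico _ (by omega)]
    choose t ht using this
    exact ⟨t, funext fun k => by simp [ht k, Finset.sum_apply]⟩
  have hz : ∀ n, φ z (i n) ≠ 0 := by
    intro n h
    obtain ⟨t, ht⟩ := htail n
    have hsum : ∑ m ∈ Finset.range n, φ (x m) (i n) = 0 :=
      Finset.sum_eq_zero fun m hm => by
        by_contra h0
        exact hJF n (F n) (hmem (Finset.mem_range.1 hm) _ h0)
    rw [ht, map_add, map_sum, map_smul, Finset.sum_range_succ, DirectSum.add_apply,
      DirectSum.add_apply, DirectSum.smul_apply, DFinsupp.finsetSum_apply, hsum, zero_add] at h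
    exact hJ n (F n) (-(φ t (i n))) (by rw [smul_neg]; exact eq_neg_of_add_eq_zero_left h)
  have hinj : Function.Injective i := by
    intro m n hmn
    by_contra hne'
    rcases lt_or_gt_of_ne hne' with hlt | hlt
    · exact hJF n (F n) (hmem hlt _ (by have := hne m; rwa [hmn] at this))
    · exact hJF m (F m) (hmem hlt _ (by have := hne n; rwa [← hmn] at this))
  exact Set.infinite_of_injective_forall_mem hinj
    (fun n => DFinsupp.mem_support_iff.2 (hz n)) (DFinsupp.support (φ z)).finite_toSet

/-- A ring over which every left module is a direct sum of cyclic modules satisfies the descending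
chain condition on principal right ideals. -/
theorem IsLeftKothe.principalRightDCC {S : Type u} [Ring S] [Infinite S]
    (h : IsLeftKothe.{u, max u w} S) : PrincipalRightDCC S := by
  classical
  intro q hq
  by_contra! hnot
  obtain ⟨I, N, hN, hcyc⟩ := h (ℕ → ULift.{w} S → S)
  let φ : (ℕ → ULift.{w} S → S) ≃ₗ[S] DirectSum I fun i => N i :=
    (LinearEquiv.ofBijective (DirectSum.coeLinearMap N) hN).symm
  obtain ⟨n, F, hF⟩ := exists_finset_component_mem_smul (fun i => N i) φ.toLinearMap q hq
  -- One element for each of the `2 ^ |S|` subsets; `ULift` only adjusts the universe.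
  let x : Set (ULift.{w} S) → ℕ → ULift.{w} S → S :=
    fun B => Pi.single n (B.indicator fun _ => q n)
  have hx : ∀ B, ∀ i ∉ F, ∃ y : N i, φ (x B) i = q (n + 1) • y := fun B => by
    refine hF (x B) (fun k hk => Pi.single_eq_of_ne hk.ne _) fun k => ?_
    by_cases hk : k = n
    · subst hk
      refine ⟨B.indicator fun _ => 1, ?_⟩
      ext s
      by_cases hs : s ∈ B <;> simp [x, hs]
    · exact ⟨0, by simp [x, hk]⟩
  let f : Set (ULift.{w} S) → ∀ i : F, N i := fun B i => φ (x B) i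
  -- If the components in `F` agree, all components of the difference are divisible by `q (n + 1)`.
  -- At a point of just one of `B`, `C` this would put `q n` in `q (n + 1) S`.
  have hf : Function.Injective f := by
    intro B C hBC
    have hcomp : ∀ i, ∃ y : N i, φ (x B - x C) i = q (n + 1) • y := fun i => by
      by_cases hi : i ∈ F
      · refine ⟨0, ?_⟩
        rw [smul_zero, map_sub, DirectSum.sub_apply, sub_eq_zero]
        exact congrFun hBC ⟨i, hi⟩
      · obtain ⟨y, hy⟩ := hx B i hi
        obtain ⟨y', hy'⟩ := hx C i hi
        exact ⟨y - y', by rw [map_sub, DirectSum.sub_apply, hy, hy', smul_sub]⟩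
    choose y hy using hcomp
    have hdiv : ∃ t, φ (x B - x C) = q (n + 1) • t := by
      refine ⟨DFinsupp.mk (DFinsupp.support (φ (x B - x C))) fun i => y i, ?_⟩
      refine DFinsupp.ext fun i => ?_
      rw [DirectSum.smul_apply]
      by_cases hi : i ∈ DFinsupp.support (φ (x B - x C))
      · rw [DFinsupp.mk_of_mem hi]; exact hy i
      · rw [DFinsupp.mk_of_notMem hi, smul_zero]; exact DFinsupp.notMem_support_iff.1 hi
    obtain ⟨t, ht⟩ := hdiv
    rw [← φ.apply_symm_apply t, ← map_smul] at ht
    have hcoord := φ.injective ht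
    ext s
    have hs := congrFun (congrFun hcoord n) s
    simp only [x, Pi.sub_apply, Pi.single_eq_same, Pi.smul_apply, smul_eq_mul] at hs
    by_cases hB : s ∈ B <;> by_cases hC : s ∈ C <;> simp only [hB, hC, Set.indicator_of_mem,
      Set.indicator_of_notMem, not_false_eq_true, sub_zero, zero_sub] at hs ⊢
    · exact (hnot n ⟨_, hs⟩).elim
    · exact (hnot n ⟨-_, by rw [mul_neg, ← hs, neg_neg]⟩).elim
  have hg : ∀ i, ∃ g : S → N i, Function.Surjective g := fun i => by
    obtain ⟨a, ha⟩ := (hcyc i).principal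
    have hmem : ∀ s : S, s • a ∈ N i := fun s => by
      rw [ha]; exact Submodule.smul_mem _ s (Submodule.mem_span_singleton_self a)
    refine ⟨fun s => ⟨s • a, hmem s⟩, fun b => ?_⟩
    obtain ⟨s, hs⟩ := Submodule.mem_span_singleton.1 (ha.le b.2)
    exact ⟨s, Subtype.ext hs⟩
  choose g hg using hg
  obtain ⟨r, hr⟩ := (Function.Surjective.piMap fun i : F => hg i).hasRightInverse
  have hpow : Cardinal.mk (Fin F.card → S) ≤ Cardinal.mk S := by
    simpa using Cardinal.power_nat_le (n := F.card) (Cardinal.aleph0_le_mk S)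
  obtain ⟨k⟩ := Cardinal.le_def _ _ |>.1 hpow
  let e : (F → S) ≃ (Fin F.card → S) := F.equivFin.arrowCongr (Equiv.refl S)
  exact Function.cantor_injective (fun B => ULift.up.{w} (k (e (r (f B))))) fun B C hBC =>
    hf (hr.injective (e.injective (k.injective (ULift.up_injective hBC))))

/-! ### Semisimplicity and the converse -/

open MonoidAlgebra in
/-- Maschke's theorem over a division ring. -/
theorem MonoidAlgebra.isSemisimpleRing_of_divisionRing (R : Type u) [DivisionRing R] (G : Type v)
    [Group G] [Finite G] (hG : (Nat.card G : R) ≠ 0) : IsSemisimpleRing (MonoidAlgebra R G) := by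
  classical
  have := Fintype.ofFinite G
  refine (isSemisimpleModule_iff _ _).2 ⟨fun p => ?_⟩
  obtain ⟨π, hπ⟩ := (p.restrictScalars R).subtype.exists_leftInverse_of_injective
    (Submodule.ker_subtype _)
  have hπ' : ∀ x (hx : x ∈ p), π x = ⟨x, hx⟩ := fun x hx =>
    LinearMap.congr_fun hπ (⟨x, hx⟩ : p.restrictScalars R)
  -- Averaging an `R`-linear projection onto `p`, before division by the order of `G`.
  let T : MonoidAlgebra R G → MonoidAlgebra R G := fun x =>
    ∑ g : G, single g⁻¹ (1 : R) * (π (single g (1 : R) * x) : MonoidAlgebra R G)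
  have hTadd : ∀ x y, T (x + y) = T x + T y := fun x y => by
    simp [T, mul_add, Finset.sum_add_distrib]
  have hcomm : ∀ (g : G) (r : R) x, single g (1 : R) * (r • x) = r • (single g (1 : R) * x) :=
    fun g r x => by
      have hr : ∀ y : MonoidAlgebra R G, r • y = single 1 r * y := fun y => by
        rw [← mul_one r, ← smul_single' r (1 : G) (1 : R), smul_mul_assoc, ← one_def, one_mul,
          mul_one]
      rw [hr, hr, ← mul_assoc, ← mul_assoc, single_mul_single, single_mul_single]
      simp
  have hTsmul : ∀ (r : R) x, T (r • x) = r • T x := fun r x => by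
    simp [T, Finset.smul_sum, hcomm]
  have hTgroup : ∀ (h : G) x, T (single h 1 * x) = single h 1 * T x := fun h x => by
    simp only [T, Finset.mul_sum]
    refine Fintype.sum_bijective (· * h) (Group.mulRight_bijective h) _ _ fun g => ?_
    simp [← mul_assoc, single_mul_single]
  have hTmem : ∀ x, T x ∈ p := fun x =>
    Submodule.sum_mem _ fun g _ => p.smul_mem (single g⁻¹ (1 : R)) (π (single g (1 : R) * x)).2
  have hTp : ∀ x ∈ p, T x = Nat.card G * x := fun x hx => by
    have : ∀ g : G, single g⁻¹ (1 : R) * (π (single g (1 : R) * x) : MonoidAlgebra R G) = x :=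
      fun g => by
        rw [hπ' (single g (1 : R) * x) (p.smul_mem (single g (1 : R)) hx), ← mul_assoc,
          single_mul_single]
        simp [← one_def]
    simp only [T, this]
    simp
  have hTlin : ∀ a x, T (a * x) = a * T x := fun a x => by
    induction a using MonoidAlgebra.induction_on with
    | of g => exact hTgroup g x
    | add a b ha hb => rw [add_mul, hTadd, ha, hb, add_mul]
    | smul r a ha => rw [smul_mul_assoc, hTsmul, ha, smul_mul_assoc]
  let u : MonoidAlgebra R G := single 1 (Nat.card G : R)⁻¹
  have hu : u * Nat.card G = 1 := by
    rw [natCast_def, single_mul_single, inv_mul_cancel₀ hG, one_mul, one_def]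
  have hu' : (Nat.card G : MonoidAlgebra R G) * u = 1 := by
    rw [natCast_def, single_mul_single, mul_inv_cancel₀ hG, one_mul, one_def]
  have hucomm : ∀ a, u * a = a * u := fun a => by
    calc u * a = u * (a * Nat.card G) * u := by rw [mul_assoc, mul_assoc, hu', mul_one]
      _ = a * u := by rw [← Nat.cast_comm, ← mul_assoc, hu, one_mul]
  let f : MonoidAlgebra R G →ₗ[MonoidAlgebra R G] p :=
    { toFun := fun x => ⟨u * T x, p.smul_mem u (hTmem x)⟩
      map_add' := fun x y => Subtype.ext (by simp [hTadd, mul_add])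
      map_smul' := fun a x => Subtype.ext (by
        simp [hTlin, ← mul_assoc, hucomm a]) }
  exact ⟨LinearMap.ker f, LinearMap.isCompl_of_proj fun x => Subtype.ext (by
    change u * T x = x
    rw [hTp _ x.2, ← mul_assoc, hu, one_mul])⟩

/-- Over a semisimple ring, every left module is a direct sum of cyclic modules. -/
theorem IsLeftKothe.of_isSemisimpleRing (S : Type u) [Ring S] [IsSemisimpleRing S] :
    IsLeftKothe.{u, w} S := by
  classical
  intro M _ _
  obtain ⟨s, hind, htop, hsimple⟩ := IsSemisimpleModule.exists_sSupIndep_sSup_simples_eq_top S M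
  refine ⟨s, Subtype.val, ?_, fun N => ?_⟩
  · convert DirectSum.isInternal_submodule_of_iSupIndep_of_iSup_eq_top ((sSupIndep_iff _).1 hind)
      (by rw [← sSup_eq_iSup', htop])
  · have := hsimple N N.2
    have := IsSimpleModule.nontrivial S N.1
    obtain ⟨x, hx⟩ := exists_ne (0 : N.1)
    refine ⟨x, le_antisymm (fun y hy => ?_) ?_⟩
    · obtain ⟨a, ha⟩ := IsSimpleModule.toSpanSingleton_surjective S hx ⟨y, hy⟩
      exact Submodule.mem_span_singleton.2 ⟨a, congrArg Subtype.val ha⟩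
    · exact (Submodule.span_singleton_le_iff_mem _ _).2 x.2

/-! ### Consequences of the chain condition -/

namespace PrincipalRightDCC

theorem of_surjective {S T : Type*} [Monoid S] [Monoid T] (h : PrincipalRightDCC S) (f : S →* T)
    (hf : Function.Surjective f) : PrincipalRightDCC T := by
  intro q hq
  choose c hc using hq
  choose g hg using hf
  let p : ℕ → S := fun n => Nat.rec (g (q 0)) (fun n s => s * g (c n)) n
  have hp : ∀ n, f (p n) = q n := fun n => by
    induction n with
    | zero => exact hg _
    | succ n ih => rw [hc, ← ih]; exact (map_mul f _ _).trans (by rw [hg])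
  obtain ⟨n, hn⟩ := h p fun n => ⟨g (c n), rfl⟩
  exact ⟨n, by rw [← hp, ← hp]; exact map_dvd f hn⟩

theorem exists_minimal {S : Type*} [Monoid S] (h : PrincipalRightDCC S) (P : S → Prop)
    (hP : ∃ b, P b) : ∃ b, P b ∧ ∀ c, P (b * c) → b * c ∣ b := by
  by_contra! H
  obtain ⟨b₀, hb₀⟩ := hP
  choose c hc hcd using H
  let q : ℕ → {b // P b} :=
    fun n => Nat.rec ⟨b₀, hb₀⟩ (fun _ b => ⟨b.1 * c b.1 b.2, hc b.1 b.2⟩) n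
  obtain ⟨n, hn⟩ := h (fun n => (q n).1) fun n => ⟨c (q n).1 (q n).2, rfl⟩
  exact hcd (q n).1 (q n).2 hn

/-- In a semiprime ring with the descending chain condition on principal right ideals, the kernel
of a homomorphism to a domain is annihilated by an element outside of it. -/
theorem exists_annihilator {S D : Type*} [Ring S] [Ring D] [Nontrivial D] [NoZeroDivisors D]
    (h : PrincipalRightDCC S) (hsemiprime : ∀ x : S, x ≠ 0 → ∃ s, x * s * x ≠ 0) (f : S →+* D) :
    ∃ b, f b ≠ 0 ∧ ∀ w, f w = 0 → b * w = 0 := by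
  obtain ⟨b, hb, hbmin⟩ := h.exists_minimal (fun b => f b ≠ 0) ⟨1, by simp⟩
  refine ⟨b, hb, fun w hw => ?_⟩
  by_contra hbw
  obtain ⟨x, ⟨hx0, hbx⟩, hxmin⟩ := h.exists_minimal (fun x => x ≠ 0 ∧ b * w ∣ x)
    ⟨b * w, hbw, dvd_rfl⟩
  have hxmin' : ∀ c, x * c ≠ 0 → x * c ∣ x := fun c hc => hxmin c ⟨hc, hbx.mul_right c⟩
  obtain ⟨s, hs⟩ := hsemiprime x hx0
  have hinj : ∀ c, x * s * (x * c) = 0 → x * c = 0 := fun c hc => by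
    by_contra hne
    obtain ⟨d, hd⟩ := hxmin' c hne
    exact hs (by rw [hd, ← mul_assoc _ _ d, ← hd, hc, zero_mul])
  obtain ⟨t, ht⟩ := hxmin' (s * x) (by rwa [← mul_assoc])
  -- `x * (t * s)` is an idempotent generator of the minimal right ideal `x S`
  have hfix : x * s * (x * (t * s)) = x * s := by
    calc x * s * (x * (t * s)) = x * (s * x) * t * s := by simp only [mul_assoc]
      _ = x * s := by rw [← ht]
  obtain ⟨e, he⟩ : ∃ e, e = x * (t * s) := ⟨_, rfl⟩
  rw [← he] at hfix
  have he0 : e ≠ 0 := fun h0 => hs (by rw [← hfix, h0, mul_zero, zero_mul])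
  have hee : e * e = e := by
    have := hinj (t * s * e - t * s) (by
      rw [mul_sub, ← mul_assoc x, ← he, mul_sub, ← mul_assoc, hfix, hfix, sub_self])
    rwa [mul_sub, ← mul_assoc x, ← he, sub_eq_zero] at this
  obtain ⟨k, hk⟩ := hbx
  obtain ⟨v, hv⟩ : ∃ v, e = b * v := ⟨w * k * (t * s), by rw [he, hk]; simp only [mul_assoc]⟩
  have hfe : f e = 0 := by rw [he, hk]; simp [hw]
  -- Cutting `b` down by `1 - e` keeps its image nonzero, so minimality puts `b` in `(1 - e) b S`.
  -- Hence `e * b = 0`, although `e = b * v` is idempotent.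
  have hcut : b * (1 - v * b) = (1 - e) * b := by rw [hv]; noncomm_ring
  obtain ⟨y, hy⟩ := hbmin (1 - v * b) (by rw [hcut]; simpa [hfe] using hb)
  apply he0
  calc e = e * e := hee.symm
    _ = e * (b * v) := by rw [← hv]
    _ = e * ((1 - e) * b * y * v) := by rw [← hcut, ← hy]
    _ = (e - e * e) * (b * y * v) := by noncomm_ring
    _ = 0 := by rw [hee, sub_self, zero_mul]

end PrincipalRightDCC

/-! ### Finite conjugacy classes -/

theorem finiteIndex_centralizer_singleton_iff {G : Type*} [Group G] (g : G) :
    (Subgroup.centralizer {g}).FiniteIndex ↔ (conjugatesOf g).Finite := by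
  have key : ∀ a b : G, a * g * a⁻¹ = b * g * b⁻¹ ↔ a⁻¹ * b ∈ Subgroup.centralizer {g} := by
    intro a b
    rw [Subgroup.mem_centralizer_singleton_iff]
    constructor
    · intro h
      have := congrArg (fun z => a⁻¹ * z * b) h
      simpa [mul_assoc] using this.symm
    · intro h
      have := congrArg (fun z => a * z * b⁻¹) h
      simpa [mul_assoc] using this.symm
  let f : G ⧸ Subgroup.centralizer {g} → G := Quotient.lift (fun a => a * g * a⁻¹) fun a b h =>
    (key a b).2 (QuotientGroup.leftRel_apply.1 h)
  have hf : Function.Injective f := by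
    rintro ⟨a⟩ ⟨b⟩ h
    exact QuotientGroup.eq.2 ((key a b).1 h)
  have hrange : Set.range f = conjugatesOf g := by
    ext y
    change _ ↔ IsConj g y
    rw [isConj_iff]
    constructor
    · rintro ⟨⟨a⟩, rfl⟩
      exact ⟨a, rfl⟩
    · rintro ⟨a, rfl⟩
      exact ⟨QuotientGroup.mk a, rfl⟩
  rw [← hrange, Set.finite_range_iff hf]
  exact Subgroup.finiteIndex_iff_finite_quotient

/-- The subgroup of the elements with finitely many conjugates. -/
def fcCenter (G : Type*) [Group G] : Subgroup G where
  carrier := {g | (conjugatesOf g).Finite}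
  one_mem' := by
    refine (Set.finite_singleton (1 : G)).subset fun y hy => ?_
    exact isConj_one_right.1 hy
  mul_mem' {a b} ha hb := by
    refine (Set.Finite.mul ha hb).subset fun y hy => ?_
    obtain ⟨c, rfl⟩ := isConj_iff.1 hy
    exact ⟨c * a * c⁻¹, isConj_iff.2 ⟨c, rfl⟩, c * b * c⁻¹, isConj_iff.2 ⟨c, rfl⟩, by group⟩
  inv_mem' {a} ha := by
    refine (Set.Finite.inv ha).subset fun y hy => ?_
    obtain ⟨c, rfl⟩ := isConj_iff.1 hy
    exact isConj_iff.2 ⟨c, by group⟩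

theorem mem_fcCenter {G : Type*} [Group G] {g : G} :
    g ∈ fcCenter G ↔ (conjugatesOf g).Finite := Iff.rfl

instance fcCenter_normal (G : Type*) [Group G] : (fcCenter G).Normal where
  conj_mem g hg c := by
    have h : IsConj g (c * g * c⁻¹) := isConj_iff.2 ⟨c, rfl⟩
    rw [mem_fcCenter] at hg ⊢
    rwa [← h.conjugatesOf_eq]

/-- If the FC-center is finite, the quotient by it has no nontrivial finite conjugacy class. -/
theorem conjugatesOf_infinite_of_finite_fcCenter {G : Type*} [Group G] [Finite (fcCenter G)]
    (x : G ⧸ fcCenter G) (hx : x ≠ 1) : (conjugatesOf x).Infinite := by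
  intro hfin
  induction x using QuotientGroup.induction_on with
  | H g =>
    refine hx ((QuotientGroup.eq_one_iff g).2 ?_)
    have hpre : ((QuotientGroup.mk' (fcCenter G)) ⁻¹'
        conjugatesOf (g : G ⧸ fcCenter G)).Finite := by
      refine hfin.preimage' fun b _ => ?_
      obtain ⟨a, rfl⟩ := QuotientGroup.mk'_surjective _ b
      refine ((Set.toFinite (fcCenter G : Set G)).image (a * ·)).subset fun y hy => ?_
      exact ⟨a⁻¹ * y, QuotientGroup.eq.1 hy.symm, by simp⟩
    exact mem_fcCenter.2 (hpre.subset fun y hy =>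
      MonoidHom.map_isConj (QuotientGroup.mk' (fcCenter G)) hy)

/-- A group generated by finitely many elements with finite conjugacy classes is finite if it is
torsion. -/
theorem finite_closure_of_subset_fcCenter {G : Type*} [Group G] (htor : ∀ g : G, IsOfFinOrder g)
    (T : Set G) (hT : T.Finite) (hTC : T ⊆ fcCenter G) : Finite (Subgroup.closure T) := by
  have := hT.to_subtype
  have : Group.FG (Subgroup.closure T) := inferInstance
  -- What commutes with all generators is central in the closure, so the center has finite index; it
  -- is then finitely generated, abelian and torsion.
  have hfi : (⨅ t : T, Subgroup.centralizer {(t : G)}).FiniteIndex :=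
    Subgroup.finiteIndex_iInf fun t => (finiteIndex_centralizer_singleton_iff _).2 (hTC t.2)
  have hle : (⨅ t : T, Subgroup.centralizer {(t : G)}).subgroupOf (Subgroup.closure T) ≤
      Subgroup.center (Subgroup.closure T) := by
    intro z hz
    have hz' : (z : G) ∈ Subgroup.centralizer (Subgroup.closure T : Set G) := by
      rw [Subgroup.centralizer_closure, Subgroup.mem_centralizer_iff]
      intro t ht
      exact Subgroup.mem_centralizer_iff.1 (Subgroup.mem_iInf.1 hz ⟨t, ht⟩) t rfl
    exact Subgroup.mem_center_iff.2 fun y =>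
      Subtype.ext (Subgroup.mem_centralizer_iff.1 hz' y y.2)
  have : (Subgroup.center (Subgroup.closure T)).FiniteIndex := Subgroup.finiteIndex_of_le hle
  let : CommGroup (Subgroup.center (Subgroup.closure T)) :=
    { (inferInstance : Group (Subgroup.center (Subgroup.closure T))) with mul_comm := mul_comm' }
  have : Finite (Subgroup.center (Subgroup.closure T)) :=
    CommGroup.finite_of_fg_isMulTorsion _ fun z => by
      have := htor (z : Subgroup.closure T)
      rwa [Submonoid.isOfFinOrder_coe, Submonoid.isOfFinOrder_coe] at this
  exact Finite.of_equiv _ (Subgroup.groupEquivQuotientProdSubgroup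
    (s := Subgroup.center (Subgroup.closure T))).symm

/-! ### Group rings with the chain condition -/

open MonoidAlgebra
open scoped Pointwise

/-- The augmentation homomorphism of a group ring. -/
noncomputable def augmentation (R G : Type*) [Ring R] [Group G] : MonoidAlgebra R G →+* R :=
  liftNCRingHom (RingHom.id R) (1 : G →* R) fun _ _ => Commute.one_right _

theorem augmentation_single {R G : Type*} [Ring R] [Group G] (g : G) (r : R) :
    augmentation R G (single g r) = r := by
  simp [augmentation, liftNCRingHom]

/-- If no nontrivial conjugacy class of `G` is finite, then the group ring is semiprime. -/
theorem MonoidAlgebra.exists_mul_mul_ne_zero {R G : Type*} [Ring R] [NoZeroDivisors R] [Group G]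
    (hG : ∀ g : G, g ≠ 1 → (conjugatesOf g).Infinite) (x : MonoidAlgebra R G) (hx : x ≠ 0) :
    ∃ s, x * s * x ≠ 0 := by
  classical
  obtain ⟨h, hh⟩ : ∃ h, x.coeff h ≠ 0 := by
    by_contra! H
    exact hx (by ext g; simpa using H g)
  -- For such `g` the coefficient of `x * g * x` at `h * g * h` is a single product. Bad `g` lie in
  -- finitely many cosets of centralizers; if these covered `G`, B. H. Neumann's lemma would give a
  -- centralizer of finite index.
  obtain ⟨g, hg⟩ : ∃ g : G, ∀ a ∈ x.coeff.support, ∀ b ∈ x.coeff.support,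
      a * g * b = h * g * h → a = h ∧ b = h := by
    by_contra! H
    let s := (x.coeff.support.erase h) ×ˢ (x.coeff.support.erase h)
    have hrep : ∀ p : G × G, ∃ k : G, ∀ g, p.1 * g * p.2 = h * g * h →
        p.1 * k * p.2 = h * k * h := fun p => by
      by_cases hp : ∃ k, p.1 * k * p.2 = h * k * h
      · exact ⟨hp.choose, fun _ _ => hp.choose_spec⟩
      · exact ⟨1, fun g hg => (hp ⟨g, hg⟩).elim⟩
    choose k hk using hrep
    have hcover : ⋃ p ∈ s, k p • (Subgroup.centralizer {h * p.2⁻¹} : Set G) = Set.univ := by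
      refine Set.eq_univ_of_forall fun g => ?_
      obtain ⟨a, ha, b, hb, hab, hne⟩ := H g
      have hah : a ≠ h := by
        rintro rfl
        exact hne rfl (mul_left_cancel hab)
      have hbh : b ≠ h := by
        rintro rfl
        exact hah (mul_right_cancel (mul_right_cancel hab))
      refine Set.mem_iUnion₂.2 ⟨(a, b), Finset.mem_product.2
        ⟨Finset.mem_erase.2 ⟨hah, ha⟩, Finset.mem_erase.2 ⟨hbh, hb⟩⟩, ?_⟩
      have hkab := hk (a, b) g hab
      rw [Set.mem_smul_set_iff_inv_smul_mem, smul_eq_mul, SetLike.mem_coe,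
        Subgroup.mem_centralizer_singleton_iff]
      have hconj : ∀ c : G, a * c * b = h * c * h → c * (h * b⁻¹) = h⁻¹ * a * c := fun c hc => by
        rw [mul_assoc h⁻¹, eq_mul_inv_of_mul_eq hc]
        group
      calc (k (a, b))⁻¹ * g * (h * b⁻¹) = (k (a, b))⁻¹ * (h⁻¹ * a * k (a, b)) * (k (a, b))⁻¹ * g := by
            rw [mul_assoc _ g, hconj g hab]; group
        _ = h * b⁻¹ * ((k (a, b))⁻¹ * g) := by rw [← hconj _ hkab]; group
    obtain ⟨p, hp, hfi⟩ := Subgroup.exists_finiteIndex_of_leftCoset_cover hcover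
    refine hG (h * p.2⁻¹) (fun h1 => ?_) ((finiteIndex_centralizer_singleton_iff _).1 hfi)
    exact (Finset.mem_erase.1 (Finset.mem_product.1 hp).2).1 (mul_inv_eq_one.1 h1).symm
  refine ⟨single g 1, fun h0 => ?_⟩
  have huniq : UniqueMul (x * single g 1).coeff.support x.coeff.support (h * g) h := by
    intro a b ha hb hab
    have ha' : a * g⁻¹ ∈ x.coeff.support := by
      rw [Finsupp.mem_support_iff] at ha ⊢
      simpa using ha
    obtain ⟨h1, h2⟩ := hg _ ha' b hb (by simpa using hab)
    exact ⟨mul_inv_eq_iff_eq_mul.1 h1, h2⟩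
  have := coeff_mul_mul_of_uniqueMul huniq
  rw [h0] at this
  simp [hh] at this

section

variable {R G : Type*} [DivisionRing R] [Group G]

/-- A group without nontrivial finite conjugacy classes is finite if its group ring satisfies the
descending chain condition on principal right ideals. -/
theorem PrincipalRightDCC.finite_of_conjugatesOf_infinite
    (h : PrincipalRightDCC (MonoidAlgebra R G))
    (hG : ∀ g : G, g ≠ 1 → (conjugatesOf g).Infinite) : Finite G := by
  obtain ⟨b, hb, hann⟩ := h.exists_annihilator (exists_mul_mul_ne_zero hG) (augmentation R G)
  have hfix : ∀ g : G, b * single g 1 = b := fun g => by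
    have := hann (single g 1 - 1) (by rw [map_sub, augmentation_single, map_one, sub_self])
    rwa [mul_sub, mul_one, sub_eq_zero] at this
  obtain ⟨k, hk⟩ : ∃ k, b.coeff k ≠ 0 := by
    by_contra! H
    exact hb (by rw [show b = 0 by ext g; simpa using H g, map_zero])
  refine Set.finite_univ_iff.1 (b.coeff.support.finite_toSet.subset fun g _ => ?_)
  rw [Finset.mem_coe, Finsupp.mem_support_iff]
  have := congrArg (fun z => z.coeff k) (hfix (g⁻¹ * k))
  simp at this
  rwa [this]

/-- For `x` of infinite order, left multiplication by `x - 1` is injective, since a nonzero element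
it kills would have infinite support. Stabilization of the powers then makes `x - 1` right
invertible, though its augmentation is zero. -/
theorem PrincipalRightDCC.isOfFinOrder (h : PrincipalRightDCC (MonoidAlgebra R G)) (x : G) :
    IsOfFinOrder x := by
  by_contra hx
  obtain ⟨d, hd⟩ : ∃ d : MonoidAlgebra R G, d = single x 1 - 1 := ⟨_, rfl⟩
  have hreg : ∀ z, d * z = 0 → z = 0 := by
    intro z hz
    rw [hd, sub_mul, one_mul, sub_eq_zero] at hz
    have hstep : ∀ k, z.coeff (x⁻¹ * k) = z.coeff k := fun k => by
      simpa using congrArg (fun y => y.coeff k) hz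
    have hpow : ∀ (n : ℕ) k, z.coeff ((x⁻¹) ^ n * k) = z.coeff k := fun n k => by
      induction n with
      | zero => simp
      | succ n ih => rw [pow_succ', mul_assoc, hstep, ih]
    by_contra hne
    obtain ⟨k, hk⟩ : ∃ k, z.coeff k ≠ 0 := by
      by_contra! H
      exact hne (by ext g; simpa using H g)
    have hinj : Function.Injective fun n : ℕ => x⁻¹ ^ n * k := fun m n hmn =>
      injective_pow_iff_not_isOfFinOrder.2 (by rwa [isOfFinOrder_inv_iff])
        (mul_right_cancel hmn)
    exact Set.infinite_of_injective_forall_mem hinj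
      (fun n => Finsupp.mem_support_iff.2 (by rwa [hpow])) z.coeff.support.finite_toSet
  have hregpow : ∀ (n : ℕ) z, d ^ n * z = 0 → z = 0 := fun n => by
    induction n with
    | zero => intro z hz; simpa using hz
    | succ n ih => intro z hz; exact hreg z (ih _ (by rwa [← mul_assoc, ← pow_succ]))
  obtain ⟨n, y, hy⟩ := h (fun n => d ^ n) fun n => ⟨d, pow_succ d n⟩
  have h1 : d * y = 1 := by
    rw [← sub_eq_zero]
    apply hregpow n
    rw [mul_sub, mul_one, ← mul_assoc, ← pow_succ, ← hy, sub_self]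
  have := congrArg (augmentation R G) h1
  rw [map_mul, hd, map_sub, augmentation_single, map_one, sub_self, zero_mul] at this
  exact zero_ne_one this

variable (R) in
/-- The sum of the elements of a finite subset of `G`, in the group ring. -/
noncomputable def setSum {G : Type*} (s : Finset G) : MonoidAlgebra R G := ∑ g ∈ s, single g 1

theorem coeff_setSum {R G : Type*} [DivisionRing R] [DecidableEq G] (s : Finset G) (g : G) :
    (setSum R s).coeff g = if g ∈ s then 1 else 0 := by
  simp [setSum, Finsupp.single_apply]

theorem single_mul_setSum {s : Finset G} {K : Subgroup G} (hs : (s : Set G) = K) {g : G}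
    (hg : g ∈ K) : single g 1 * setSum R s = setSum R s := by
  have hmem : ∀ k, k ∈ s ↔ k ∈ K := fun k => by rw [← Finset.mem_coe, hs, SetLike.mem_coe]
  rw [setSum, Finset.mul_sum]
  refine Finset.sum_equiv (Equiv.mulLeft g) (fun k => ?_) fun k _ => ?_
  · simp [hmem, K.mul_mem_cancel_left hg]
  · simp [single_mul_single]

/-- A finite subgroup `H` whose sum is minimal is the whole FC-center: enlarging `H` by `g` gives a
finite `K`, and minimality makes the sum of `H` a right multiple of that of `K`, hence fixed by `g`.
-/
theorem PrincipalRightDCC.finite_fcCenter [CharZero R]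
    (h : PrincipalRightDCC (MonoidAlgebra R G)) : Finite (fcCenter G) := by
  classical
  let P : MonoidAlgebra R G → Prop := fun b =>
    ∃ (H : Subgroup G) (s : Finset G), (s : Set G) = H ∧ H ≤ fcCenter G ∧ b = setSum R s
  obtain ⟨b, ⟨H, s, hs, hH, rfl⟩, hmin⟩ := h.exists_minimal P
    ⟨setSum R {1}, ⊥, {1}, by simp, bot_le, rfl⟩
  suffices hle : fcCenter G ≤ H from
    (s.finite_toSet.subset (hs ▸ hle : (fcCenter G : Set G) ⊆ s)).to_subtype
  intro g hg
  have hT : insert g (s : Set G) ⊆ fcCenter G :=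
    Set.insert_subset hg (hs ▸ hH : (s : Set G) ⊆ fcCenter G)
  have hfin := finite_closure_of_subset_fcCenter h.isOfFinOrder (insert g (s : Set G))
    (s.finite_toSet.insert g) hT
  let K := Subgroup.closure (insert g (s : Set G))
  let t : Finset G := (Set.toFinite (K : Set G)).toFinset
  have ht : (t : Set G) = K := Set.Finite.coe_toFinset _
  have hcard : (s.card : R) ≠ 0 := by
    have : (1 : G) ∈ (s : Set G) := hs ▸ H.one_mem
    exact Nat.cast_ne_zero.2 (Finset.card_ne_zero_of_mem this)
  -- Characteristic zero enters here, to invert the order of `H`.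
  have hmul : setSum R s * (setSum R t * single 1 (s.card : R)⁻¹) = setSum R t := by
    have h1 : setSum R s * setSum R t = setSum R t * s.card := by
      rw [setSum, Finset.sum_mul, Finset.sum_congr rfl fun k hk =>
        single_mul_setSum ht (Subgroup.subset_closure (Set.mem_insert_of_mem g hk)),
        Finset.sum_const, nsmul_eq_mul, Nat.cast_comm]
    rw [← mul_assoc, h1, mul_assoc, natCast_def, single_mul_single, mul_inv_cancel₀ hcard,
      one_mul, ← one_def, mul_one]
  obtain ⟨y, hy⟩ := hmin (setSum R t * single 1 (s.card : R)⁻¹)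
    ⟨K, t, ht, (Subgroup.closure_le _).2 hT, hmul⟩
  rw [hmul] at hy
  have hfix : single g 1 * setSum R s = setSum R s := by
    rw [hy, ← mul_assoc, single_mul_setSum ht (Subgroup.subset_closure (Set.mem_insert g _))]
  have hcoeff := congrArg (fun z => z.coeff g) hfix
  have h1 : (1 : G) ∈ s := by rw [← Finset.mem_coe, hs]; exact H.one_mem
  simp [coeff_setSum, h1] at hcoeff
  rw [← SetLike.mem_coe, ← hs]
  exact hcoeff

/-- A group is finite if its group ring over a division ring of characteristic zero satisfies the
descending chain condition on principal right ideals. -/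
theorem PrincipalRightDCC.finite_group [CharZero R] (h : PrincipalRightDCC (MonoidAlgebra R G)) :
    Finite G := by
  have := h.finite_fcCenter
  have hsurj : Function.Surjective (mapDomainRingHom R (QuotientGroup.mk' (fcCenter G))) := by
    intro y
    induction y using MonoidAlgebra.induction_linear with
    | zero => exact ⟨0, map_zero _⟩
    | add a b ha hb =>
      obtain ⟨a, rfl⟩ := ha
      obtain ⟨b, rfl⟩ := hb
      exact ⟨a + b, map_add _ _ _⟩
    | single g r =>
      obtain ⟨g, rfl⟩ := QuotientGroup.mk'_surjective _ g
      exact ⟨single g r, by simp⟩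
  have := (h.of_surjective (mapDomainRingHom R
    (QuotientGroup.mk' (fcCenter G))).toMonoidHom hsurj).finite_of_conjugatesOf_infinite
    conjugatesOf_infinite_of_finite_fcCenter
  exact Finite.of_equiv _ (Subgroup.groupEquivQuotientProdSubgroup (s := fcCenter G)).symm

end

instance MonoidAlgebra.infinite_of_charZero {R G : Type*} [Ring R] [CharZero R] [Group G] :
    Infinite (MonoidAlgebra R G) :=
  Infinite.of_injective (fun n : ℕ => single (1 : G) (n : R)) fun m n hmn => by
    simpa using congrArg (fun z => z.coeff 1) hmn

theorem theorem6p1 (R : Type u) [DivisionRing R] [CharZero R] (G : Type v) [Group G] :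
    List.TFAE [
      IsLeftKothe.{max u v, max u v w} (MonoidAlgebra R G),
      IsRightKothe.{max u v, max u v w} (MonoidAlgebra R G),
      Finite G] := by
  tfae_have 1 → 3 := fun h =>
    (IsLeftKothe.principalRightDCC.{max u v, w} h).finite_group
  tfae_have 2 → 3 := fun h => by
    have : Infinite (MonoidAlgebra R G)ᵐᵒᵖ := MulOpposite.opEquiv.infinite_iff.1 inferInstance
    have hdcc : PrincipalRightDCC (MonoidAlgebra R G)ᵐᵒᵖ :=
      IsLeftKothe.principalRightDCC.{max u v, w} h
    have : CharZero Rᵐᵒᵖ := ⟨fun m n hmn => Nat.cast_injective (R := R)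
      (by simpa using congrArg MulOpposite.unop hmn)⟩
    have := (hdcc.of_surjective (MonoidAlgebra.opRingEquiv (R := R) (M := G)).toMonoidHom
      MonoidAlgebra.opRingEquiv.surjective).finite_group
    exact Finite.of_equiv _ MulOpposite.opEquiv.symm
  tfae_have 3 → 1 := fun _ => by
    have := MonoidAlgebra.isSemisimpleRing_of_divisionRing R G
      (Nat.cast_ne_zero.2 Nat.card_pos.ne')
    exact IsLeftKothe.of_isSemisimpleRing _
  tfae_have 3 → 2 := fun _ => by
    have := MonoidAlgebra.isSemisimpleRing_of_divisionRing R G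
      (Nat.cast_ne_zero.2 Nat.card_pos.ne')
    exact IsLeftKothe.of_isSemisimpleRing (MonoidAlgebra R G)ᵐᵒᵖ
  tfae_finish
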